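/- Let $m\ge 1$, $d=2^m$, and let $\mathbb C^d$ have computational basis $|x\rangle$, $x\in\mathbb F_2^m$. Define the Fibonacci polynomials over $\mathbb F_2$ by $F_0=0$, $F_1=1$, $F_{n+1}=xF_n+F_{n-1}$; the Fibonacci index of an irreducible $p\in\mathbb F_2[x]$ is the least $n\ge 1$ with $p\mid F_n$. For $a=(a^z,a^x)\in\mathbb F_2^{2m}$ let $ZX(a)=\bigotimes_{k=1}^m(-i)^{a^z_ka^x_k}Z^{a^z_k}X^{a^x_k}$ be the corresponding $m$-qubit Pauli operator, where $Z|i\rangle=(-1)^i|i\rangle$ and $X|i\rangle=|i+1\rangle$ for $i\in\mathbb F_2$. Let $B\in M_m(\mathbb F_2)$ be a symmetric matrix whose characteristic polynomial is irreducible with Fibonacci index $2^m+1$, and put $$C=\begin{pmatrix}B&1_m\\1_m&0_m\end{pmatrix},\qquad G_j=C^j\begin{pmatrix}1_m\\0_m\end{pmatrix},\qquad \mathcal C_j=\{ZX(G_jc):c\in\mathbb F_2^m\}\qquad(0\le j\le d).$$ A family $\mathcal B_0,\dots,\mathcal B_d$ of unitary $d\times d$ matrices is called Fibonacci-based if for some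 such $B$ the columns of $\mathcal B_j$ form an orthonormal basis of common eigenvectors of $\mathcal C_j$, for every $j=0,\dots,d$. (This includes the cyclic sets $\mathcal B_j=U^j$ generated by a unitary $U$ with $U\mathcal C_jU^\dagger=\mathcal C_{j+1 \bmod (d+1)}$ up to phases of the operators, and $U^{d+1}=1$.) Theorem (Equivalence of Fibonacci-based sets). Every Fibonacci-based family is a complete set of mutually unbiased bases, i.e. it consists of $d+1$ orthonormal bases such that $|\langle\psi|\varphi\rangle|=1/\sqrt d$ for all basis vectors $\psi,\varphi$ of two different bases. Any two Fibonacci-based families $(\mathcal B_j)$, $(\mathcal B'_j)$ in the same dimension $d=2^m$ are equivalent: whatever the underlying matrices $B,B'$ and their characteristic polynomials, there are a Clifford unitary $U\in M_d(\mathbb C)$ (a unitary that conjugates every Pauli operator to a scalar multiple of a Pauli operator), a permutation $\pi$ of $\{0,\dots,d\}$, and matrices $W_0,\dots,W_d$, each the product of a permutation matrix and a diagonal matrix of phases, such that $$\mathcal B'_j=U\,\mathcal B_{\pi(j)}\,W_j\qquad(j=0,\dots,d).$$ -/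

import Mathlib

namespace FibMUB

open Matrix Polynomial

section Fibonacci

/-- The Fibonacci polynomials over the field with two elements:
`F_0 = 0`, `F_1 = 1`, `F_(n+1) = x * F_n + F_(n-1)`. -/
noncomputable def fibPoly : ℕ → (ZMod 2)[X]
  | 0 => 0
  | 1 => 1
  | n + 2 => X * fibPoly (n + 1) + fibPoly n

/-- The polynomial `p` has Fibonacci index `n`: `n` is the least positive integer such that
`p` divides the Fibonacci polynomial `F_n`. -/
def HasFibonacciIndex (p : (ZMod 2)[X]) (n : ℕ) : Prop :=
  IsLeast {k : ℕ | 0 < k ∧ p ∣ fibPoly k} n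

/-- The reduced stabilizer matrices that the Fibonacci-based construction admits: `B` is symmetric
and its characteristic polynomial is irreducible with Fibonacci index `2 ^ m + 1`. -/
def IsReducedStabilizer {m : ℕ} (B : Matrix (Fin m) (Fin m) (ZMod 2)) : Prop :=
  B.IsSymm ∧ Irreducible B.charpoly ∧ HasFibonacciIndex B.charpoly (2 ^ m + 1)

/-- The stabilizer matrix `C = (B, 1; 1, 0)`. The left summand of the index type carries the
Pauli-`Z` half of a vector, the right summand the Pauli-`X` half. -/
def stabilizerMatrix {m : ℕ} (B : Matrix (Fin m) (Fin m) (ZMod 2)) :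
    Matrix (Fin m ⊕ Fin m) (Fin m ⊕ Fin m) (ZMod 2) :=
  fromBlocks B 1 1 0

/-- The generator matrix `G_j = C ^ j * G_0` of the `j`-th class, where `G_0 = (1, 0)ᵗ`. -/
def generator {m : ℕ} (B : Matrix (Fin m) (Fin m) (ZMod 2)) (j : ℕ) :
    Matrix (Fin m ⊕ Fin m) (Fin m) (ZMod 2) :=
  stabilizerMatrix B ^ j * fromRows 1 0

end Fibonacci

section Pauli

/-- The Pauli operator `Z` of one qubit: `Z |i⟩ = (-1) ^ i |i⟩`. -/
def pauliZ : Matrix (ZMod 2) (ZMod 2) ℂ :=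
  diagonal fun i => (-1 : ℂ) ^ i.val

/-- The Pauli operator `X` of one qubit: `X |i⟩ = |i + 1⟩`. -/
def pauliX : Matrix (ZMod 2) (ZMod 2) ℂ :=
  of fun i j => if i = j + 1 then 1 else 0

/-- The one-qubit Pauli operator `(-i) ^ (k * l) * Z ^ k * X ^ l`. -/
noncomputable def pauliZX₁ (k l : ZMod 2) : Matrix (ZMod 2) (ZMod 2) ℂ :=
  (-Complex.I) ^ (k.val * l.val) • (pauliZ ^ k.val * pauliX ^ l.val)

/-- The Pauli operator of `m` qubits with argument `a = (a^z, a^x)`: the tensor product over `k`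
of the one-qubit operators with arguments `a^z_k, a^x_k`. The computational basis of the Hilbert
space of dimension `2 ^ m` is indexed by the bit strings `Fin m → ZMod 2`. -/
noncomputable def pauliZX {m : ℕ} (a : Fin m ⊕ Fin m → ZMod 2) :
    Matrix (Fin m → ZMod 2) (Fin m → ZMod 2) ℂ :=
  of fun x y => ∏ k : Fin m, pauliZX₁ (a (Sum.inl k)) (a (Sum.inr k)) (x k) (y k)

/-- The `j`-th class of Pauli operators of the construction, with the identity included:
all `ZX(a)` with `a = G_j c`. -/
def pauliClass {m : ℕ} (B : Matrix (Fin m) (Fin m) (ZMod 2)) (j : ℕ) :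
    Set (Matrix (Fin m → ZMod 2) (Fin m → ZMod 2) ℂ) :=
  {A | ∃ c : Fin m → ZMod 2, A = pauliZX (generator B j *ᵥ c)}

/-- The Clifford unitaries: they conjugate every Pauli operator to a Pauli operator, where, as
usual, Pauli operators that differ by a scalar factor are identified. -/
def IsClifford {m : ℕ} (U : Matrix (Fin m → ZMod 2) (Fin m → ZMod 2) ℂ) : Prop :=
  U ∈ unitaryGroup (Fin m → ZMod 2) ℂ ∧
    ∀ a : Fin m ⊕ Fin m → ZMod 2, ∃ (b : Fin m ⊕ Fin m → ZMod 2) (ω : ℂ),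
      U * pauliZX a * Uᴴ = ω • pauliZX b

end Pauli

section Bases

variable {ι : Type*} [Fintype ι] [DecidableEq ι]

/-- The columns of the matrix `V` form an orthonormal basis of common eigenvectors of all
operators in the set `𝒞`. -/
def IsCommonEigenbasis (V : Matrix ι ι ℂ) (𝒞 : Set (Matrix ι ι ℂ)) : Prop :=
  V ∈ unitaryGroup ι ℂ ∧ ∀ A ∈ 𝒞, ∀ i : ι, ∃ μ : ℂ, A *ᵥ V.col i = μ • V.col i

/-- A family of `r` mutually unbiased bases, each given by a unitary matrix whose columns are
the basis vectors. -/
def IsMUB {r : ℕ} (S : Fin r → Matrix ι ι ℂ) : Prop :=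
  (∀ k, S k ∈ unitaryGroup ι ℂ) ∧
    ∀ k l, k ≠ l → ∀ i j : ι,
      ‖star ((S k).col i) ⬝ᵥ (S l).col j‖ = 1 / Real.sqrt (Fintype.card ι : ℝ)

/-- Monomial phase matrices: a permutation matrix times a diagonal matrix of phases. -/
def IsMonomialPhase (W : Matrix ι ι ℂ) : Prop :=
  ∃ (σ : Equiv.Perm ι) (φ : ι → ℂ), (∀ i, ‖φ i‖ = 1) ∧
    W = Equiv.Perm.permMatrix ℂ σ * diagonal φ

/-- The unitary `U` carries the family of bases `S` to the family `S'`, up to the order of the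
bases and up to the order and the phases of the vectors within each basis. -/
def IsEquivalenceOfBases {r : ℕ} (U : Matrix ι ι ℂ) (S S' : Fin r → Matrix ι ι ℂ) : Prop :=
  U ∈ unitaryGroup ι ℂ ∧ ∃ π : Equiv.Perm (Fin r), ∀ j : Fin r,
    ∃ W : Matrix ι ι ℂ, IsMonomialPhase W ∧ S' j = U * S (π j) * W

end Bases

/-- A family of `2 ^ m + 1` bases that arises from the Fibonacci-based construction: for some
admissible reduced stabilizer matrix `B`, the `j`-th basis is a common orthonormal eigenbasis of
the `j`-th class of Pauli operators, for `j = 0, …, 2 ^ m`. -/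
def IsFibonacciBased {m : ℕ}
    (S : Fin (2 ^ m + 1) → Matrix (Fin m → ZMod 2) (Fin m → ZMod 2) ℂ) : Prop :=
  ∃ B : Matrix (Fin m) (Fin m) (ZMod 2), IsReducedStabilizer B ∧
    ∀ j : Fin (2 ^ m + 1), IsCommonEigenbasis (S j) (pauliClass B (j : ℕ))

end FibMUB

/-! Irreducibility of the characteristic polynomial makes `F_2[B]` a field `K` of order `2 ^ m`, and
symmetry of `B` makes all its elements symmetric matrices. Powers of `C` have Fibonacci polynomials
in `B` as blocks (`generator_eq`), so class `0` is the subspace `x = 0` and, for `1 ≤ j ≤ 2 ^ m`,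
class `j` is the graph `z = s_j x` with `s_j = F_(j+1) / F_j` in `K`. D'Ocagne's identity and
minimality of the Fibonacci index make these slopes distinct, so they exhaust `K`: the classes are
the points of the projective line over `K`, and only their order depends on the choice of generator.

Unbiasedness: the Pauli expectations of a stabilized state have modulus one on its class and vanish
off it. Distinct classes meet only in `0`, so Parseval (`sum_expectation_mul_star`) gives squared
overlap `1 / 2 ^ m`. The same computation for one class gives overlaps of modulus `0` or `1`, so an
eigenbasis is unique up to order and phases.

Equivalence: the actions of `K` through `B` and `B'` are intertwined by some invertible `Q`. By
symmetry of both, `Q Qᵀ` commutes with the second action, hence is an element `t` of it. The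
symplectic map `diag(Q, Q⁻ᵀ)` then fixes the point at infinity and sends slope `s` to `s t`
(`exists_blockMap`). It is implemented by a linear permutation of the computational basis, which is
the required Clifford unitary. -/

namespace FibMUB

open Matrix Polynomial

/-! ### Pauli matrices: entries, unitarity, completeness. -/

section PauliEntries

/-- The nontrivial additive character of the field with two elements. -/
noncomputable def signChar : AddChar (ZMod 2) ℂ :=
  AddChar.zmodChar 2 (ζ := -1) (by norm_num)

lemma signChar_sum {ι : Type*} (s : Finset ι) (f : ι → ZMod 2) :
    signChar (∑ i ∈ s, f i) = ∏ i ∈ s, signChar (f i) :=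
  map_prod signChar.toMonoidHom (fun i => Multiplicative.ofAdd (f i)) s

lemma zmod_two_cases (x : ZMod 2) : x = 0 ∨ x = 1 := by
  revert x
  decide

lemma pauliZX₁_apply (k l x y : ZMod 2) :
    pauliZX₁ k l x y =
      (-Complex.I) ^ (k.val * l.val) * (if x = y + l then signChar (k * x) else 0) := by
  have h2 : (ZMod.val (1 : ZMod 2)) = 1 := rfl
  have h3 : (1 : ZMod 2) + 1 = 0 := rfl
  rcases zmod_two_cases k with rfl | rfl <;>
    rcases zmod_two_cases l with rfl | rfl <;>
    rcases zmod_two_cases x with rfl | rfl <;>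
    rcases zmod_two_cases y with rfl | rfl <;>
    simp [pauliZX₁, pauliZ, pauliX, signChar, AddChar.zmodChar_apply, h2, h3]

lemma pauliZX₁_sum_mul_star (x y x' y' : ZMod 2) :
    ∑ p : ZMod 2 × ZMod 2, pauliZX₁ p.1 p.2 x y * star (pauliZX₁ p.1 p.2 x' y') =
      if x = x' ∧ y = y' then 2 else 0 := by
  have h2 : (ZMod.val (1 : ZMod 2)) = 1 := rfl
  have h3 : (1 : ZMod 2) + 1 = 0 := rfl
  have hu : (Finset.univ : Finset (ZMod 2)) = {0, 1} := rfl
  simp only [Fintype.sum_prod_type, hu, pauliZX₁_apply]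
  rcases zmod_two_cases x with rfl | rfl <;>
    rcases zmod_two_cases y with rfl | rfl <;>
    rcases zmod_two_cases x' with rfl | rfl <;>
    rcases zmod_two_cases y' with rfl | rfl <;>
    simp [signChar, AddChar.zmodChar_apply, h2, h3] <;> norm_num

lemma pauliZX₁_row_orthonormal (k l x z : ZMod 2) :
    ∑ y : ZMod 2, star (pauliZX₁ k l y x) * pauliZX₁ k l y z = if x = z then 1 else 0 := by
  have h2 : (ZMod.val (1 : ZMod 2)) = 1 := rfl
  have h3 : (1 : ZMod 2) + 1 = 0 := rfl
  have hu : (Finset.univ : Finset (ZMod 2)) = {0, 1} := rfl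
  simp only [hu, pauliZX₁_apply]
  rcases zmod_two_cases k with rfl | rfl <;>
    rcases zmod_two_cases l with rfl | rfl <;>
    rcases zmod_two_cases x with rfl | rfl <;>
    rcases zmod_two_cases z with rfl | rfl <;>
    simp [signChar, AddChar.zmodChar_apply, h2, h3]

variable {m : ℕ}

/-- The scalar factor of a Pauli operator. -/
noncomputable def pauliPhase (a : Fin m ⊕ Fin m → ZMod 2) : ℂ :=
  ∏ k : Fin m, (-Complex.I) ^ ((a (Sum.inl k)).val * (a (Sum.inr k)).val)

lemma pauliPhase_ne_zero (a : Fin m ⊕ Fin m → ZMod 2) : pauliPhase a ≠ 0 :=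
  Finset.prod_ne_zero_iff.2 fun _ _ => pow_ne_zero _ (by simp)

lemma pauliZX_apply (a : Fin m ⊕ Fin m → ZMod 2) (x y : Fin m → ZMod 2) :
    pauliZX a x y =
      pauliPhase a * if x = y + a ∘ Sum.inr then signChar ((a ∘ Sum.inl) ⬝ᵥ x) else 0 := by
  simp only [pauliZX, of_apply, pauliZX₁_apply, Finset.prod_mul_distrib, pauliPhase]
  congr 1
  split_ifs with h
  · rw [dotProduct, signChar_sum]
    refine Finset.prod_congr rfl fun k _ => ?_
    rw [if_pos (show x k = y k + a (Sum.inr k) from congrFun h k)]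
    rfl
  · obtain ⟨k, hk⟩ := Function.ne_iff.1 h
    exact Finset.prod_eq_zero (Finset.mem_univ k) (if_neg hk)

lemma pauliZX_zero : pauliZX (0 : Fin m ⊕ Fin m → ZMod 2) = 1 := by
  ext x y
  have h : ((0 : Fin m ⊕ Fin m → ZMod 2) ∘ Sum.inr) = 0 := rfl
  have h' : ((0 : Fin m ⊕ Fin m → ZMod 2) ∘ Sum.inl) = 0 := rfl
  simp [pauliZX_apply, pauliPhase, one_apply, h, h']

lemma prod_ite_eq_ite_funext {ι R : Type*} [Fintype ι] [CommSemiring R] (P : ι → Prop)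
    [DecidablePred P] [Decidable (∀ i, P i)] (c : R) :
    ∏ i, (if P i then c else 0) = if ∀ i, P i then c ^ Fintype.card ι else 0 := by
  split_ifs with h
  · simp [h]
  · push Not at h
    obtain ⟨i, hi⟩ := h
    exact Finset.prod_eq_zero (Finset.mem_univ i) (if_neg hi)

lemma pauliZX_conjTranspose_mul_self (a : Fin m ⊕ Fin m → ZMod 2) :
    (pauliZX a)ᴴ * pauliZX a = 1 := by
  ext x z
  simp only [mul_apply, conjTranspose_apply, pauliZX, of_apply, star_prod,
    ← Finset.prod_mul_distrib]
  have h := Finset.prod_univ_sum (fun _ : Fin m => (Finset.univ : Finset (ZMod 2)))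
    fun k y => star (pauliZX₁ (a (Sum.inl k)) (a (Sum.inr k)) y (x k)) *
      pauliZX₁ (a (Sum.inl k)) (a (Sum.inr k)) y (z k)
  rw [Fintype.piFinset_univ] at h
  rw [← h]
  simp only [pauliZX₁_row_orthonormal, one_apply]
  rw [prod_ite_eq_ite_funext]
  simp [funext_iff]

/-- Completeness of the Pauli operators. -/
lemma pauliZX_sum_mul_star (x y x' y' : Fin m → ZMod 2) :
    ∑ a : Fin m ⊕ Fin m → ZMod 2, pauliZX a x y * star (pauliZX a x' y') =
      if x = x' ∧ y = y' then 2 ^ m else 0 := by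
  -- Regrouping the two halves of `a` qubit by qubit factors the sum into one-qubit sums.
  let e : (Fin m ⊕ Fin m → ZMod 2) ≃ (Fin m → ZMod 2 × ZMod 2) :=
    (Equiv.sumArrowEquivProdArrow _ _ _).trans (Equiv.arrowProdEquivProdArrow _ _ _).symm
  have h := Finset.prod_univ_sum (fun _ : Fin m => (Finset.univ : Finset (ZMod 2 × ZMod 2)))
    fun k p => pauliZX₁ p.1 p.2 (x k) (y k) * star (pauliZX₁ p.1 p.2 (x' k) (y' k))
  rw [Fintype.piFinset_univ] at h
  have h2 : ∑ a : Fin m ⊕ Fin m → ZMod 2, pauliZX a x y * star (pauliZX a x' y') =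
      ∑ p : Fin m → ZMod 2 × ZMod 2, ∏ k, pauliZX₁ (p k).1 (p k).2 (x k) (y k) *
        star (pauliZX₁ (p k).1 (p k).2 (x' k) (y' k)) := by
    refine Fintype.sum_equiv e _ _ fun a => ?_
    simp only [pauliZX, of_apply, star_prod, ← Finset.prod_mul_distrib]
    rfl
  rw [h2, ← h]
  simp only [pauliZX₁_sum_mul_star]
  rw [prod_ite_eq_ite_funext]
  simp [funext_iff, forall_and]

end PauliEntries

/-! ### Overlaps of stabilized states through Pauli expectations. -/

section Overlaps

variable {m : ℕ}

/-- The expectation of a Pauli operator in the state `ψ`. -/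
noncomputable def expectation (ψ : (Fin m → ZMod 2) → ℂ) (a : Fin m ⊕ Fin m → ZMod 2) : ℂ :=
  star ψ ⬝ᵥ (pauliZX a *ᵥ ψ)

/-- The unit vector `ψ` is an eigenvector of every Pauli operator with argument in `L`. -/
def IsStabilized (L : Finset (Fin m ⊕ Fin m → ZMod 2)) (ψ : (Fin m → ZMod 2) → ℂ) : Prop :=
  star ψ ⬝ᵥ ψ = 1 ∧ ∀ a ∈ L, ∃ μ : ℂ, pauliZX a *ᵥ ψ = μ • ψ

lemma expectation_zero (ψ : (Fin m → ZMod 2) → ℂ) (h : star ψ ⬝ᵥ ψ = 1) :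
    expectation ψ 0 = 1 := by
  simp [expectation, pauliZX_zero, h]

lemma IsStabilized.mulVec_eq {L : Finset (Fin m ⊕ Fin m → ZMod 2)}
    {ψ : (Fin m → ZMod 2) → ℂ} (h : IsStabilized L ψ) {a : Fin m ⊕ Fin m → ZMod 2}
    (ha : a ∈ L) : pauliZX a *ᵥ ψ = expectation ψ a • ψ := by
  obtain ⟨μ, hμ⟩ := h.2 a ha
  rw [expectation, hμ, dotProduct_smul, h.1, smul_eq_mul, mul_one]

lemma star_mulVec_dotProduct_pauliZX (a : Fin m ⊕ Fin m → ZMod 2)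
    (ψ φ : (Fin m → ZMod 2) → ℂ) :
    star (pauliZX a *ᵥ ψ) ⬝ᵥ (pauliZX a *ᵥ φ) = star ψ ⬝ᵥ φ := by
  rw [star_mulVec, ← dotProduct_mulVec, mulVec_mulVec, pauliZX_conjTranspose_mul_self,
    one_mulVec]

/-- Pauli operators are unitary and so preserve overlaps; if the overlap is nonzero, cancelling it
shows that both states have the same eigenvalue. -/
lemma IsStabilized.star_expectation_mul {L : Finset (Fin m ⊕ Fin m → ZMod 2)}
    {ψ φ : (Fin m → ZMod 2) → ℂ} (h : IsStabilized L ψ) (h' : IsStabilized L φ)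
    {a : Fin m ⊕ Fin m → ZMod 2} (ha : a ∈ L) :
    star (expectation ψ a) * expectation φ a * (star ψ ⬝ᵥ φ) = star ψ ⬝ᵥ φ := by
  have := star_mulVec_dotProduct_pauliZX a ψ φ
  rw [h.mulVec_eq ha, h'.mulVec_eq ha, star_smul, smul_dotProduct, dotProduct_smul,
    smul_eq_mul, smul_eq_mul] at this
  rw [mul_assoc, this]

lemma IsStabilized.star_expectation_mul_self {L : Finset (Fin m ⊕ Fin m → ZMod 2)}
    {ψ : (Fin m → ZMod 2) → ℂ} (h : IsStabilized L ψ)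
    {a : Fin m ⊕ Fin m → ZMod 2} (ha : a ∈ L) :
    star (expectation ψ a) * expectation ψ a = 1 := by
  simpa [h.1] using h.star_expectation_mul h ha

lemma expectation_eq_sum (ψ : (Fin m → ZMod 2) → ℂ) (a : Fin m ⊕ Fin m → ZMod 2) :
    expectation ψ a = ∑ p : (Fin m → ZMod 2) × (Fin m → ZMod 2),
      star (ψ p.1) * ψ p.2 * pauliZX a p.1 p.2 := by
  simp only [expectation, dotProduct, mulVec, Fintype.sum_prod_type, Finset.mul_sum, Pi.star_apply]
  refine Finset.sum_congr rfl fun x _ => Finset.sum_congr rfl fun y _ => by ring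

/-- Parseval's identity for the Pauli operators. -/
lemma sum_expectation_mul_star (ψ φ : (Fin m → ZMod 2) → ℂ) :
    ∑ a, expectation ψ a * star (expectation φ a) =
      2 ^ m * ((star ψ ⬝ᵥ φ) * star (star ψ ⬝ᵥ φ)) := by
  calc ∑ a, expectation ψ a * star (expectation φ a)
      = ∑ a, ∑ p : (Fin m → ZMod 2) × (Fin m → ZMod 2),
          ∑ q : (Fin m → ZMod 2) × (Fin m → ZMod 2),
          (star (ψ p.1) * ψ p.2 * (φ q.1 * star (φ q.2))) *
            (pauliZX a p.1 p.2 * star (pauliZX a q.1 q.2)) := by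
        refine Finset.sum_congr rfl fun a _ => ?_
        rw [expectation_eq_sum, expectation_eq_sum, star_sum, Finset.sum_mul_sum]
        refine Finset.sum_congr rfl fun p _ => Finset.sum_congr rfl fun q _ => ?_
        simp only [star_mul', star_star]
        ring
    _ = ∑ p : (Fin m → ZMod 2) × (Fin m → ZMod 2),
          ∑ q : (Fin m → ZMod 2) × (Fin m → ZMod 2),
          (star (ψ p.1) * ψ p.2 * (φ q.1 * star (φ q.2))) * (if p = q then 2 ^ m else 0) := by
        rw [Finset.sum_comm]
        refine Finset.sum_congr rfl fun p _ => ?_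
        rw [Finset.sum_comm]
        refine Finset.sum_congr rfl fun q _ => ?_
        rw [← Finset.mul_sum, pauliZX_sum_mul_star]
        simp only [Prod.ext_iff]
    _ = 2 ^ m * ((star ψ ⬝ᵥ φ) * star (star ψ ⬝ᵥ φ)) := by
        simp only [mul_ite, mul_zero, Finset.sum_ite_eq, Finset.mem_univ, if_true]
        simp only [dotProduct, star_sum, Pi.star_apply, star_mul', star_star]
        rw [Finset.sum_mul_sum, Finset.mul_sum, Fintype.sum_prod_type]
        refine Finset.sum_congr rfl fun x _ => ?_
        rw [Finset.mul_sum]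
        exact Finset.sum_congr rfl fun y _ => by ring

/-- Parseval with `φ = ψ` allots total weight `2 ^ m`, and the unimodular eigenvalues on `L` already
use it up. -/
lemma IsStabilized.expectation_eq_zero {L : Finset (Fin m ⊕ Fin m → ZMod 2)}
    (hL : L.card = 2 ^ m) {ψ : (Fin m → ZMod 2) → ℂ} (h : IsStabilized L ψ)
    {a : Fin m ⊕ Fin m → ZMod 2} (ha : a ∉ L) : expectation ψ a = 0 := by
  have h1 := sum_expectation_mul_star ψ ψ
  rw [h.1, star_one, mul_one, mul_one, ← Finset.sum_add_sum_compl L] at h1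
  have h2 : ∑ b ∈ L, expectation ψ b * star (expectation ψ b) = 2 ^ m := by
    rw [Finset.sum_congr rfl fun b hb => (mul_comm _ _).trans (h.star_expectation_mul_self hb)]
    simp [hL]
  rw [h2, add_eq_left] at h1
  have h3 : ∑ b ∈ Lᶜ, ‖expectation ψ b‖ ^ 2 = 0 := by
    have : ((∑ b ∈ Lᶜ, ‖expectation ψ b‖ ^ 2 : ℝ) : ℂ) = 0 := by
      rw [← h1]
      push_cast
      exact Finset.sum_congr rfl fun b _ => (Complex.mul_conj' _).symm
    exact_mod_cast this
  have h4 := (Finset.sum_eq_zero_iff_of_nonneg fun b _ => by positivity).1 h3 a (by simpa using ha)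
  simpa using h4

lemma norm_sq_overlap (ψ φ : (Fin m → ZMod 2) → ℂ) {r : ℝ}
    (h : ∑ a, expectation ψ a * star (expectation φ a) = 2 ^ m * (r : ℂ)) :
    ‖star ψ ⬝ᵥ φ‖ ^ 2 = r := by
  rw [sum_expectation_mul_star] at h
  have h2 := mul_left_cancel₀ (pow_ne_zero m two_ne_zero) h
  have h3 : ((‖star ψ ⬝ᵥ φ‖ ^ 2 : ℝ) : ℂ) = r := by
    rw [← h2]
    push_cast
    exact (Complex.mul_conj' _).symm
  exact_mod_cast h3

/-- States that are stabilized by two sets of Pauli operators with trivial intersection are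
unbiased. -/
lemma IsStabilized.norm_overlap_of_disjoint {L L' : Finset (Fin m ⊕ Fin m → ZMod 2)}
    (hL : L.card = 2 ^ m) (hL' : L'.card = 2 ^ m) (hd : ∀ a ∈ L, a ∈ L' → a = 0)
    {ψ φ : (Fin m → ZMod 2) → ℂ} (h : IsStabilized L ψ) (h' : IsStabilized L' φ) :
    ‖star ψ ⬝ᵥ φ‖ = 1 / Real.sqrt (2 ^ m) := by
  have h1 : ‖star ψ ⬝ᵥ φ‖ ^ 2 = 1 / 2 ^ m := by
    refine norm_sq_overlap ψ φ ?_
    -- Off `0`, at least one of the two expectations vanishes.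
    rw [Finset.sum_eq_single 0]
    · simp [expectation_zero ψ h.1, expectation_zero φ h'.1]
    · intro a _ ha
      by_cases haL : a ∈ L
      · have : a ∉ L' := fun hb => ha (hd a haL hb)
        rw [h'.expectation_eq_zero hL' this, star_zero, mul_zero]
      · rw [h.expectation_eq_zero hL haL, zero_mul]
    · simp
  rw [← Real.sqrt_sq (norm_nonneg _), h1, Real.sqrt_div zero_le_one, Real.sqrt_one]

/-- Two states that are stabilized by the same maximal set of Pauli operators are orthogonal
or equal up to a phase. -/
lemma IsStabilized.overlap_eq_zero_or_norm_eq_one {L : Finset (Fin m ⊕ Fin m → ZMod 2)}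
    (hL : L.card = 2 ^ m) {ψ φ : (Fin m → ZMod 2) → ℂ}
    (h : IsStabilized L ψ) (h' : IsStabilized L φ) :
    star ψ ⬝ᵥ φ = 0 ∨ ‖star ψ ⬝ᵥ φ‖ = 1 := by
  by_cases h0 : star ψ ⬝ᵥ φ = 0
  · exact Or.inl h0
  right
  -- A nonzero overlap forces equal eigenvalues on all of `L`, so every term of Parseval's sum over
  -- `L` equals one.
  have h1 : ∀ a ∈ L, star (expectation ψ a) * expectation φ a = 1 := fun a ha =>
    mul_right_cancel₀ h0 ((h.star_expectation_mul h' ha).trans (one_mul _).symm)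
  have h2 : ‖star ψ ⬝ᵥ φ‖ ^ 2 = 1 := by
    refine norm_sq_overlap ψ φ ?_
    rw [← Finset.sum_subset (Finset.subset_univ L)]
    · have : ∀ a ∈ L, expectation ψ a * star (expectation φ a) = 1 := fun a ha => by
        simpa [mul_comm] using congrArg star (h1 a ha)
      rw [Finset.sum_congr rfl this]
      simp [hL]
    · intro a _ ha
      rw [h.expectation_eq_zero hL ha, zero_mul]
  exact (pow_eq_one_iff_of_nonneg (norm_nonneg _) two_ne_zero).1 h2

end Overlaps

/-! ### Unitary matrices with entries of modulus zero or one. -/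

section Monomial

variable {ι : Type*} [Fintype ι] [DecidableEq ι]

lemma unitary_col_dotProduct {V : Matrix ι ι ℂ} (hV : V ∈ unitaryGroup ι ℂ) (i : ι) :
    star (V.col i) ⬝ᵥ V.col i = 1 := by
  have := congrFun (congrFun (mem_unitaryGroup_iff'.1 hV) i) i
  rwa [one_apply_eq] at this

/-- A unitary matrix whose entries are zeros and phases is monomial. -/
lemma isMonomialPhase_of_unitary {W : Matrix ι ι ℂ} (hW : W ∈ unitaryGroup ι ℂ)
    (h : ∀ i j, W i j = 0 ∨ ‖W i j‖ = 1) : IsMonomialPhase W := by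
  have hrow : ∀ i, ∑ j, ‖W i j‖ ^ 2 = 1 := fun i => by
    have := congrFun (congrFun (mem_unitaryGroup_iff.1 hW) i) i
    rw [one_apply_eq, mul_apply] at this
    have h2 : ((∑ j, ‖W i j‖ ^ 2 : ℝ) : ℂ) = 1 := by
      rw [← this]
      push_cast
      exact Finset.sum_congr rfl fun j _ => (Complex.mul_conj' _).symm
    exact_mod_cast h2
  have hcol : ∀ j, ∑ i, ‖W i j‖ ^ 2 = 1 := fun j => by
    have := congrFun (congrFun (mem_unitaryGroup_iff'.1 hW) j) j
    rw [one_apply_eq, mul_apply] at this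
    have h2 : ((∑ i, ‖W i j‖ ^ 2 : ℝ) : ℂ) = 1 := by
      rw [← this]
      push_cast
      exact Finset.sum_congr rfl fun i _ => (Complex.conj_mul' _).symm
    exact_mod_cast h2
  have unique : ∀ f : ι → ℂ, ∑ j, ‖f j‖ ^ 2 = 1 → ∀ i j, ‖f i‖ = 1 → ‖f j‖ = 1 → i = j := by
    intro f hf i j hi hj
    by_contra hij
    have := Finset.sum_le_sum_of_subset_of_nonneg (f := fun j => ‖f j‖ ^ 2)
      (Finset.subset_univ {i, j}) (fun _ _ _ => by positivity)
    rw [Finset.sum_pair hij, hi, hj, hf] at this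
    norm_num at this
  have hex : ∀ i, ∃ j, ‖W i j‖ = 1 := fun i => by
    by_contra! hc
    have := hrow i
    rw [Finset.sum_eq_zero fun j _ => by simp [(h i j).resolve_right (hc j)]] at this
    exact zero_ne_one this
  choose s hs using hex
  -- Two rows with their phase in the same column would give that column norm greater than one.
  have hinj : Function.Injective s := fun i i' hii => by
    refine unique (fun k => W k (s i)) (hcol (s i)) i i' (hs i) ?_
    rw [hii]
    exact hs i'
  let σ : Equiv.Perm ι := Equiv.ofBijective s (Finite.injective_iff_bijective.1 hinj)
  refine ⟨σ, fun j => W (σ.symm j) j, fun j => ?_, ?_⟩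
  · have := hs (σ.symm j)
    rwa [show s (σ.symm j) = j from σ.apply_symm_apply j] at this
  · ext i j
    rw [mul_diagonal, Equiv.Perm.permMatrix, PEquiv.toMatrix_apply]
    by_cases hij : σ i = j
    · subst hij
      simp
    · have h2 : W i j = 0 := (h i j).resolve_right fun hc =>
        hij (unique (W i) (hrow i) _ _ (hs i) hc)
      simp [h2, hij]

end Monomial

/-! ### The field generated by `B` and the classes as points of its projective line. -/

section FieldRepresentation

variable {m : ℕ}

lemma fibPoly_add_two (n : ℕ) : fibPoly (n + 2) = X * fibPoly (n + 1) + fibPoly n := rfl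

/-- D'Ocagne's identity modulo two. -/
lemma fibPoly_dOcagne (n j : ℕ) :
    fibPoly (j + n + 1) * fibPoly j + fibPoly (j + n) * fibPoly (j + 1) = fibPoly n := by
  induction j with
  | zero => simp [fibPoly]
  | succ j ih =>
    rw [show j + 1 + n + 1 = (j + n) + 2 by ring, show j + 1 + n = j + n + 1 by ring,
      fibPoly_add_two, fibPoly_add_two, ← ih]
    -- Expanding the recurrence produces the term `X * F_(j+n+1) * F_(j+1)` twice.
    have h2 : (2 : (ZMod 2)[X]) = 0 := CharTwo.two_eq_zero
    linear_combination (X * fibPoly (j + n + 1) * fibPoly (j + 1)) * h2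

lemma generator_eq_mul (B : Matrix (Fin m) (Fin m) (ZMod 2)) (j : ℕ) :
    generator B j = Matrix.instHMulOfFintypeOfMulOfAddCommMonoid.hMul
      (stabilizerMatrix B ^ j) (fromRows 1 0) := rfl

/-- Multiplication by `C` is the Fibonacci recurrence in block form. -/
lemma generator_eq (B : Matrix (Fin m) (Fin m) (ZMod 2)) (j : ℕ) :
    generator B j = fromRows (aeval B (fibPoly (j + 1))) (aeval B (fibPoly j)) := by
  induction j with
  | zero => simp [generator_eq_mul, fibPoly]
  | succ j ih =>
    have h : generator B (j + 1) = stabilizerMatrix B * generator B j := by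
      rw [generator_eq_mul, pow_succ', Matrix.mul_assoc, generator_eq_mul]
    rw [h, ih, stabilizerMatrix, fromBlocks_mul_fromRows, fibPoly_add_two]
    simp

/-- The arguments of the Pauli operators in the `j`-th class. -/
def classArgs (B : Matrix (Fin m) (Fin m) (ZMod 2)) (j : ℕ) :
    Finset (Fin m ⊕ Fin m → ZMod 2) :=
  Finset.univ.image fun c => generator B j *ᵥ c

lemma mem_classArgs {B : Matrix (Fin m) (Fin m) (ZMod 2)} {j : ℕ}
    {v : Fin m ⊕ Fin m → ZMod 2} :
    v ∈ classArgs B j ↔ ∃ c, v ∘ Sum.inl = aeval B (fibPoly (j + 1)) *ᵥ c ∧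
      v ∘ Sum.inr = aeval B (fibPoly j) *ᵥ c := by
  simp only [classArgs, Finset.mem_image, Finset.mem_univ, true_and, generator_eq,
    fromRows_mulVec]
  refine exists_congr fun c => ⟨?_, fun ⟨h1, h2⟩ => ?_⟩
  · rintro rfl
    exact ⟨rfl, rfl⟩
  · rw [← h1, ← h2, Sum.elim_comp_inl_inr]

/-- The algebra generated by `B` is a field of order `2 ^ m` which consists of symmetric
matrices, and the first `2 ^ m` Fibonacci polynomials do not vanish at its generator. -/
structure FieldRep (B : Matrix (Fin m) (Fin m) (ZMod 2)) where
  /-- The embedding of the field. -/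
  toAlgHom : GaloisField 2 m →ₐ[ZMod 2] Matrix (Fin m) (Fin m) (ZMod 2)
  /-- The field element that represents `B`. -/
  gen : GaloisField 2 m
  map_gen : toAlgHom gen = B
  isSymm : ∀ k, (toAlgHom k).IsSymm
  fib_ne_zero : ∀ j, 0 < j → j ≤ 2 ^ m → aeval gen (fibPoly j) ≠ 0

lemma isSymm_aeval {B : Matrix (Fin m) (Fin m) (ZMod 2)} (hB : B.IsSymm) (q : (ZMod 2)[X]) :
    (aeval B q).IsSymm := by
  induction q using Polynomial.induction_on' with
  | add p q hp hq => rw [map_add]; exact hp.add hq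
  | monomial n a =>
    rw [aeval_monomial, ← Algebra.smul_def]
    exact (hB.pow n).smul a

/-- `GaloisField 2 m` serves as one model for all `B`, so that two representations share their
domain. The identification with `F_2[X] / (charpoly)` is arbitrary; the generators for different `B`
need not be related. -/
lemma IsReducedStabilizer.nonempty_fieldRep {B : Matrix (Fin m) (Fin m) (ZMod 2)}
    (hB : IsReducedStabilizer B) : Nonempty (FieldRep B) := by
  obtain ⟨hsymm, hirr, hfib⟩ := hB
  have : Fact (Irreducible B.charpoly) := ⟨hirr⟩
  have hfr : Module.finrank (ZMod 2) (AdjoinRoot B.charpoly) = m := by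
    rw [(AdjoinRoot.powerBasis hirr.ne_zero).finrank, AdjoinRoot.powerBasis_dim,
      charpoly_natDegree_eq_dim, Fintype.card_fin]
  have : Module.Finite (ZMod 2) (AdjoinRoot B.charpoly) :=
    (AdjoinRoot.powerBasis hirr.ne_zero).finite
  have hcard : Nat.card (AdjoinRoot B.charpoly) = 2 ^ m := by
    rw [Module.natCard_eq_pow_finrank (K := ZMod 2), hfr, Nat.card_zmod]
  let e : GaloisField 2 m ≃ₐ[ZMod 2] AdjoinRoot B.charpoly :=
    (GaloisField.algEquivGaloisField 2 m hcard).symm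
  let f : AdjoinRoot B.charpoly →ₐ[ZMod 2] Matrix (Fin m) (Fin m) (ZMod 2) :=
    Ideal.Quotient.liftₐ (Ideal.span {B.charpoly}) (aeval B) fun a ha => by
      obtain ⟨c, rfl⟩ := Ideal.mem_span_singleton.1 ha
      rw [map_mul, aeval_self_charpoly, zero_mul]
  have hf : ∀ q, f (AdjoinRoot.mk B.charpoly q) = aeval B q := fun q => rfl
  refine ⟨⟨f.comp (e : GaloisField 2 m →ₐ[ZMod 2] AdjoinRoot B.charpoly),
    e.symm (AdjoinRoot.root B.charpoly), ?_, fun k => ?_, fun j hj hjm h0 => ?_⟩⟩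
  · simpa using (hf X).trans (aeval_X B)
  · obtain ⟨q, hq⟩ := AdjoinRoot.mk_surjective (e k)
    have : f (e k) = aeval B q := by rw [← hq, hf]
    simpa [this] using isSymm_aeval hsymm q
  · have h1 := congrArg e h0
    rw [map_zero, ← aeval_algHom_apply, AlgEquiv.apply_symm_apply, AdjoinRoot.aeval_eq,
      AdjoinRoot.mk_eq_zero] at h1
    -- Minimality of the index gives `2 ^ m + 1 ≤ j`.
    have := hfib.2 ⟨hj, h1⟩
    omega

namespace FieldRep

variable {B B' : Matrix (Fin m) (Fin m) (ZMod 2)} (ρ : FieldRep B) (ρ' : FieldRep B')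

lemma aeval_eq (q : (ZMod 2)[X]) : aeval B q = ρ.toAlgHom (aeval ρ.gen q) := by
  rw [← aeval_algHom_apply, ρ.map_gen]

lemma mulVec_eq_zero {k : GaloisField 2 m} (hk : k ≠ 0) {c : Fin m → ZMod 2}
    (h : ρ.toAlgHom k *ᵥ c = 0) : c = 0 := by
  have h2 : ρ.toAlgHom k⁻¹ *ᵥ (ρ.toAlgHom k *ᵥ c) = c := by
    rw [mulVec_mulVec, ← map_mul, inv_mul_cancel₀ hk, map_one, one_mulVec]
  rw [← h2, h, mulVec_zero]

/-- The quotient of consecutive Fibonacci polynomials that describes the `j`-th class. -/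
noncomputable def slope (j : ℕ) : GaloisField 2 m :=
  aeval ρ.gen (fibPoly (j + 1)) / aeval ρ.gen (fibPoly j)

lemma slope_ne_of_lt {j k : ℕ} (hj : 0 < j) (hjk : j < k) (hk : k ≤ 2 ^ m) :
    ρ.slope j ≠ ρ.slope k := by
  obtain ⟨n, rfl⟩ := Nat.exists_eq_add_of_lt hjk
  intro h
  rw [slope, slope, div_eq_div_iff (ρ.fib_ne_zero _ hj (by omega))
    (ρ.fib_ne_zero _ (by omega) hk)] at h
  -- Equal slopes at `j < k` make the left side of d'Ocagne's identity a doubled term, so `F_(k-j)`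
  -- would vanish at the generator.
  have h2 := congrArg (aeval ρ.gen) (fibPoly_dOcagne (n + 1) j)
  simp only [map_add, map_mul] at h2
  rw [show j + (n + 1) = j + n + 1 by ring] at h2
  refine ρ.fib_ne_zero (n + 1) (by omega) (by omega) ?_
  rw [← h2, ← h, mul_comm (aeval ρ.gen (fibPoly (j + n + 1)))]
  exact CharTwo.add_self_eq_zero _

lemma slope_injOn {j k : ℕ} (hj : 0 < j) (hjm : j ≤ 2 ^ m) (hk : 0 < k) (hkm : k ≤ 2 ^ m)
    (h : ρ.slope j = ρ.slope k) : j = k := by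
  rcases lt_trichotomy j k with hlt | heq | hlt
  · exact absurd h (ρ.slope_ne_of_lt hj hlt hkm)
  · exact heq
  · exact absurd h.symm (ρ.slope_ne_of_lt hk hlt hjm)

/-- There are `2 ^ m` distinct slopes in a field with `2 ^ m` elements. -/
lemma exists_slope_eq (hm : m ≠ 0) (y : GaloisField 2 m) :
    ∃ j, 0 < j ∧ j ≤ 2 ^ m ∧ ρ.slope j = y := by
  let f : Fin (2 ^ m) → GaloisField 2 m := fun j => ρ.slope (j + 1)
  have hf : Function.Injective f := fun j k h => by
    have := ρ.slope_injOn (by omega) (by omega) (by omega) (by omega) h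
    exact Fin.ext (by omega)
  have : Finite (GaloisField 2 m) := Module.finite_of_finite (ZMod 2)
  have hb := (Nat.bijective_iff_injective_and_card f).2
    ⟨hf, by rw [Nat.card_fin, GaloisField.card 2 m hm]⟩
  obtain ⟨j, hj⟩ := hb.2 y
  exact ⟨j + 1, by omega, by omega, hj⟩

lemma mem_classArgs_zero {v : Fin m ⊕ Fin m → ZMod 2} :
    v ∈ classArgs B 0 ↔ v ∘ Sum.inr = 0 := by
  simp [mem_classArgs, fibPoly]

/-- The parameter `c` is eliminated by inverting `F_j`. This excludes `j = 0`, where `F_0 = 0` and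
the slope is the default value of division by zero; class `0` is the point at infinity. -/
lemma mem_classArgs_iff {j : ℕ} (hj : 0 < j) (hjm : j ≤ 2 ^ m)
    {v : Fin m ⊕ Fin m → ZMod 2} :
    v ∈ classArgs B j ↔ v ∘ Sum.inl = ρ.toAlgHom (ρ.slope j) *ᵥ (v ∘ Sum.inr) := by
  have h0 := ρ.fib_ne_zero j hj hjm
  rw [mem_classArgs, ρ.aeval_eq, ρ.aeval_eq]
  constructor
  · rintro ⟨c, h1, h2⟩
    rw [h1, h2, mulVec_mulVec, ← map_mul, slope, div_mul_cancel₀ _ h0]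
  · intro h
    refine ⟨ρ.toAlgHom (aeval ρ.gen (fibPoly j))⁻¹ *ᵥ (v ∘ Sum.inr), ?_, ?_⟩
    · rw [h, mulVec_mulVec, ← map_mul, slope, div_eq_mul_inv]
    · rw [mulVec_mulVec, ← map_mul, mul_inv_cancel₀ h0, map_one, one_mulVec]

lemma eq_zero_of_comp {v : Fin m ⊕ Fin m → ZMod 2} (h1 : v ∘ Sum.inl = 0)
    (h2 : v ∘ Sum.inr = 0) : v = 0 := by
  rw [← Sum.elim_comp_inl_inr v, h1, h2]
  exact Sum.elim_zero_zero

include ρ in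
lemma eq_zero_of_mem_classArgs {j k : ℕ} (hjm : j ≤ 2 ^ m) (hkm : k ≤ 2 ^ m) (hjk : j ≠ k)
    {v : Fin m ⊕ Fin m → ZMod 2} (hj : v ∈ classArgs B j) (hk : v ∈ classArgs B k) :
    v = 0 := by
  wlog hlt : j < k generalizing j k
  · exact this hkm hjm hjk.symm hk hj (by omega)
  rw [ρ.mem_classArgs_iff (by omega) hkm] at hk
  suffices h : v ∘ Sum.inr = 0 from eq_zero_of_comp (by rw [hk, h, mulVec_zero]) h
  rcases Nat.eq_zero_or_pos j with rfl | hj0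
  · exact mem_classArgs_zero.1 hj
  · rw [ρ.mem_classArgs_iff hj0 hjm, hk] at hj
    refine ρ.mulVec_eq_zero (sub_ne_zero.2 (ρ.slope_ne_of_lt hj0 hlt hkm).symm) ?_
    rw [map_sub, sub_mulVec, hj, sub_self]

include ρ in
lemma card_classArgs {j : ℕ} (hjm : j ≤ 2 ^ m) : (classArgs B j).card = 2 ^ m := by
  rw [classArgs, Finset.card_image_of_injective]
  · simp [ZMod.card]
  · intro c c' h
    rw [← sub_eq_zero, ← mulVec_sub, generator_eq, fromRows_mulVec, ρ.aeval_eq,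
      ρ.aeval_eq] at h
    rw [← sub_eq_zero]
    have h1 := congrArg (· ∘ Sum.inl) h
    have h2 := congrArg (· ∘ Sum.inr) h
    simp only [Sum.elim_comp_inl, Sum.elim_comp_inr] at h1 h2
    rcases Nat.eq_zero_or_pos j with rfl | hj0
    · simpa [fibPoly] using h1
    · exact ρ.mulVec_eq_zero (ρ.fib_ne_zero j hj0 hjm) h2

/-- The orbit map of a vector under the field is a linear isomorphism. -/
lemma exists_orbitEquiv (hm : m ≠ 0) {v : Fin m → ZMod 2} (hv : v ≠ 0) :
    ∃ e : GaloisField 2 m ≃ₗ[ZMod 2] (Fin m → ZMod 2), ∀ k, e k = ρ.toAlgHom k *ᵥ v := by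
  let f : GaloisField 2 m →ₗ[ZMod 2] (Fin m → ZMod 2) :=
    { toFun := fun k => ρ.toAlgHom k *ᵥ v
      map_add' := fun k l => by rw [map_add, add_mulVec]
      map_smul' := fun c k => by rw [map_smul, smul_mulVec, RingHom.id_apply] }
  have hf : Function.Injective f := by
    rw [injective_iff_map_eq_zero]
    intro k hk
    by_contra h0
    exact hv (ρ.mulVec_eq_zero h0 hk)
  exact ⟨f.linearEquivOfInjective hf (by rw [GaloisField.finrank 2 hm, Module.finrank_fin_fun]),
    fun k => rfl⟩

/-- The space is one-dimensional over the field, so a commuting `M` is determined by its value on a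
single `v ≠ 0`, and that value is `t v` for some `t`. -/
lemma exists_eq_of_commute (hm : m ≠ 0) {M : Matrix (Fin m) (Fin m) (ZMod 2)}
    (hM : ∀ k, M * ρ.toAlgHom k = ρ.toAlgHom k * M) : ∃ t, M = ρ.toAlgHom t := by
  have : Nonempty (Fin m) := ⟨⟨0, by omega⟩⟩
  obtain ⟨v, hv⟩ := exists_ne (0 : Fin m → ZMod 2)
  obtain ⟨e, he⟩ := ρ.exists_orbitEquiv hm hv
  obtain ⟨t, ht⟩ := e.surjective (M *ᵥ v)
  rw [he] at ht
  refine ⟨t, mulVec_injective ?_⟩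
  ext1 w
  obtain ⟨k, rfl⟩ := e.surjective w
  rw [he, mulVec_mulVec, hM, ← mulVec_mulVec, ← ht, mulVec_mulVec, mulVec_mulVec, ← map_mul,
    ← map_mul, mul_comm]

/-- Both actions make the space one-dimensional over the same field; `Q` matches the two orbit
parametrizations, `k v ↦ k v`. -/
lemma exists_intertwiner (hm : m ≠ 0) : ∃ Q R : Matrix (Fin m) (Fin m) (ZMod 2),
    Q * R = 1 ∧ ∀ k, Q * ρ.toAlgHom k = ρ'.toAlgHom k * Q := by
  have : Nonempty (Fin m) := ⟨⟨0, by omega⟩⟩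
  obtain ⟨v, hv⟩ := exists_ne (0 : Fin m → ZMod 2)
  obtain ⟨e, he⟩ := ρ.exists_orbitEquiv hm hv
  obtain ⟨e', he'⟩ := ρ'.exists_orbitEquiv hm hv
  refine ⟨LinearMap.toMatrix' (e.symm.trans e').toLinearMap,
    LinearMap.toMatrix' (e'.symm.trans e).toLinearMap, ?_, fun k => ?_⟩
  · rw [← LinearMap.toMatrix'_comp, ← LinearMap.toMatrix'_id]
    congr 1
    exact LinearMap.ext fun w => by simp
  · refine mulVec_injective ?_
    ext1 w
    obtain ⟨l, rfl⟩ := e.surjective w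
    have h1 : ρ.toAlgHom k *ᵥ e l = e (k * l) := by
      rw [he, he, map_mul, mulVec_mulVec]
    have h2 : ρ'.toAlgHom k *ᵥ e' l = e' (k * l) := by
      rw [he', he', map_mul, mulVec_mulVec]
    rw [← mulVec_mulVec, ← mulVec_mulVec, h1, LinearMap.toMatrix'_mulVec,
      LinearMap.toMatrix'_mulVec]
    simp [h2]

/-- The symplectic map that acts as `Q` on the `Z` half and as `Rᵀ` on the `X` half. -/
def blockMap (Q R : Matrix (Fin m) (Fin m) (ZMod 2)) (v : Fin m ⊕ Fin m → ZMod 2) :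
    Fin m ⊕ Fin m → ZMod 2 :=
  Sum.elim (Q *ᵥ (v ∘ Sum.inl)) (Rᵀ *ᵥ (v ∘ Sum.inr))

lemma blockMap_blockMap {Q R : Matrix (Fin m) (Fin m) (ZMod 2)} (hQR : Q * R = 1)
    (v : Fin m ⊕ Fin m → ZMod 2) : blockMap Q R (blockMap R Q v) = v := by
  have h : Rᵀ * Qᵀ = 1 := by rw [← transpose_mul, hQR, transpose_one]
  simp [blockMap, mulVec_mulVec, hQR, h]

lemma mulVec_left_cancel {Q R : Matrix (Fin m) (Fin m) (ZMod 2)} (h : R * Q = 1)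
    {v w : Fin m → ZMod 2} : Q *ᵥ v = Q *ᵥ w ↔ v = w := by
  refine ⟨fun hvw => ?_, fun h => by rw [h]⟩
  simpa [mulVec_mulVec, h] using congrArg (R *ᵥ ·) hvw

include ρ ρ' in
/-- A block diagonal symplectic map carries the classes of `B` to those of `B'`. -/
lemma exists_blockMap (hm : m ≠ 0) : ∃ Q R : Matrix (Fin m) (Fin m) (ZMod 2), Q * R = 1 ∧
    ∃ σ : Equiv.Perm (Fin (2 ^ m + 1)), ∀ (j : Fin (2 ^ m + 1)) v,
      v ∈ classArgs B (j : ℕ) ↔ blockMap Q R v ∈ classArgs B' (σ j : ℕ) := by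
  obtain ⟨Q, R, hQR, hQ⟩ := ρ.exists_intertwiner ρ' hm
  have hRQ : R * Q = 1 := mul_eq_one_comm.1 hQR
  have hQt : Qᵀ * Rᵀ = 1 := by rw [← transpose_mul, hRQ, transpose_one]
  -- Transposing `Q ρ(k) = ρ'(k) Q` gives `ρ(k) Qᵀ = Qᵀ ρ'(k)` because both images are symmetric, so
  -- `Q Qᵀ` commutes with `ρ'`.
  obtain ⟨t, ht⟩ := ρ'.exists_eq_of_commute hm (M := Q * Qᵀ) fun k => by
    have h2 := congrArg transpose (hQ k)
    rw [transpose_mul, transpose_mul, (ρ.isSymm k).eq, (ρ'.isSymm k).eq] at h2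
    rw [Matrix.mul_assoc, ← h2, ← Matrix.mul_assoc, hQ, Matrix.mul_assoc]
  have key : ∀ j : Fin (2 ^ m + 1), ∃ k : Fin (2 ^ m + 1), ∀ v,
      v ∈ classArgs B (j : ℕ) ↔ blockMap Q R v ∈ classArgs B' (k : ℕ) := by
    intro j
    rcases Nat.eq_zero_or_pos (j : ℕ) with hj | hj
    · refine ⟨0, fun v => ?_⟩
      rw [hj, Fin.val_zero, mem_classArgs_zero, mem_classArgs_zero, blockMap,
        Sum.elim_comp_inr, ← mulVec_left_cancel hQt, mulVec_zero]
    -- If `z = ρ(s) x`, then `Q z = ρ'(s) Q x = ρ'(s) (Q Qᵀ) (Rᵀ x) = ρ'(s t) (Rᵀ x)`.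
    · obtain ⟨k, hk, hkm, hky⟩ := ρ'.exists_slope_eq hm (ρ.slope j * t)
      refine ⟨⟨k, by omega⟩, fun v => ?_⟩
      rw [ρ.mem_classArgs_iff hj (by omega), ρ'.mem_classArgs_iff hk hkm, hky, blockMap,
        Sum.elim_comp_inl, Sum.elim_comp_inr, map_mul, ← ht, mulVec_mulVec,
        ← mulVec_left_cancel hRQ, mulVec_mulVec, hQ, Matrix.mul_assoc, Matrix.mul_assoc,
        hQt, Matrix.mul_one]
  choose s hs using key
  have hinj : Function.Injective s := fun j k hjk => by
    -- Two classes with the same image coincide, hence reduce to `{0}`, against their size `2 ^ m >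
    -- 1`.
    by_contra hne
    have hsub : classArgs B (j : ℕ) ⊆ {0} := fun v hv => by
      have hv' : v ∈ classArgs B (k : ℕ) := by rwa [hs k, ← hjk, ← hs j]
      exact Finset.mem_singleton.2
        (ρ.eq_zero_of_mem_classArgs (by omega) (by omega) (fun h => hne (Fin.ext h)) hv hv')
    have h1 := Finset.card_le_card hsub
    rw [ρ.card_classArgs (by omega), Finset.card_singleton] at h1
    exact absurd (Nat.one_lt_two_pow hm) (by omega)
  exact ⟨Q, R, hQR, Equiv.ofBijective s (Finite.injective_iff_bijective.1 hinj), hs⟩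

end FieldRep

end FieldRepresentation

/-! ### The block map as conjugation by a permutation of the computational basis. -/

section Clifford

variable {m : ℕ}

/-- The permutation `x ↦ Qᵀ x` of the computational basis. -/
def basisPerm (Q R : Matrix (Fin m) (Fin m) (ZMod 2)) (h : Q * R = 1) :
    Equiv.Perm (Fin m → ZMod 2) where
  toFun x := Qᵀ *ᵥ x
  invFun x := Rᵀ *ᵥ x
  left_inv x := by
    beta_reduce
    rw [mulVec_mulVec, ← transpose_mul, h, transpose_one, one_mulVec]
  right_inv x := by
    beta_reduce
    rw [mulVec_mulVec, ← transpose_mul, mul_eq_one_comm.1 h, transpose_one, one_mulVec]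

lemma permMatrix_mul_mul_conjTranspose {ι : Type*} [Fintype ι] [DecidableEq ι]
    (σ : Equiv.Perm ι) (M : Matrix ι ι ℂ) :
    σ.permMatrix ℂ * M * (σ.permMatrix ℂ)ᴴ = M.submatrix σ σ := by
  ext i j
  simp [Equiv.Perm.permMatrix, mul_apply, PEquiv.toMatrix_apply, Equiv.symm_apply_eq]

lemma permMatrix_mem_unitaryGroup {ι : Type*} [Fintype ι] [DecidableEq ι]
    (σ : Equiv.Perm ι) : σ.permMatrix ℂ ∈ unitaryGroup ι ℂ := by
  rw [mem_unitaryGroup_iff, star_eq_conjTranspose]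
  simpa using permMatrix_mul_mul_conjTranspose σ 1

/-- The linear substitution `x ↦ Qᵀ x` turns a shift by `a^x` into one by `Rᵀ a^x` and the character
of `a^z` into that of `Q a^z`. Only the factors `(-i)^(a^z_k a^x_k)` fail to be preserved, which
accounts for the scalar. -/
lemma pauliZX_submatrix_basisPerm {Q R : Matrix (Fin m) (Fin m) (ZMod 2)} (h : Q * R = 1)
    (a : Fin m ⊕ Fin m → ZMod 2) :
    (pauliZX a).submatrix (basisPerm Q R h) (basisPerm Q R h) =
      (pauliPhase a / pauliPhase (FieldRep.blockMap Q R a)) •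
        pauliZX (FieldRep.blockMap Q R a) := by
  ext x y
  have h1 : basisPerm Q R h x = basisPerm Q R h y + a ∘ Sum.inr ↔
      x = y + FieldRep.blockMap Q R a ∘ Sum.inr := by
    rw [FieldRep.blockMap, Sum.elim_comp_inr]
    have : a ∘ Sum.inr = basisPerm Q R h (Rᵀ *ᵥ (a ∘ Sum.inr)) :=
      ((basisPerm Q R h).apply_symm_apply _).symm
    rw [this, show basisPerm Q R h y + basisPerm Q R h (Rᵀ *ᵥ (a ∘ Sum.inr)) =
      basisPerm Q R h (y + Rᵀ *ᵥ (a ∘ Sum.inr)) from (mulVec_add Qᵀ y _).symm,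
      (basisPerm Q R h).injective.eq_iff, ← this]
  have h2 : (a ∘ Sum.inl) ⬝ᵥ basisPerm Q R h x = (FieldRep.blockMap Q R a ∘ Sum.inl) ⬝ᵥ x := by
    rw [FieldRep.blockMap, Sum.elim_comp_inl]
    change (a ∘ Sum.inl) ⬝ᵥ (Qᵀ *ᵥ x) = _
    rw [dotProduct_mulVec, vecMul_transpose]
  rw [submatrix_apply, Matrix.smul_apply, smul_eq_mul, pauliZX_apply, pauliZX_apply, h2, ← mul_assoc,
    div_mul_cancel₀ _ (pauliPhase_ne_zero _)]
  simp only [h1]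

end Clifford

/-! ### Unbiasedness and equivalence of the bases. -/

section Main

variable {m : ℕ}

lemma IsCommonEigenbasis.isStabilized {B : Matrix (Fin m) (Fin m) (ZMod 2)} {j : ℕ}
    {V : Matrix (Fin m → ZMod 2) (Fin m → ZMod 2) ℂ}
    (h : IsCommonEigenbasis V (pauliClass B j)) (i : Fin m → ZMod 2) :
    IsStabilized (classArgs B j) (V.col i) := by
  refine ⟨unitary_col_dotProduct h.1 i, fun a ha => ?_⟩
  obtain ⟨c, -, rfl⟩ := Finset.mem_image.1 ha
  exact h.2 _ ⟨c, rfl⟩ i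

lemma IsFibonacciBased.isMUB
    {S : Fin (2 ^ m + 1) → Matrix (Fin m → ZMod 2) (Fin m → ZMod 2) ℂ}
    (h : IsFibonacciBased S) : IsMUB S := by
  obtain ⟨B, hB, hS⟩ := h
  obtain ⟨ρ⟩ := hB.nonempty_fieldRep
  refine ⟨fun k => (hS k).1, fun k l hkl i j => ?_⟩
  rw [IsStabilized.norm_overlap_of_disjoint (ρ.card_classArgs (by omega))
    (ρ.card_classArgs (by omega))
    (fun a ha hb => ρ.eq_zero_of_mem_classArgs (by omega) (by omega)
      (fun h => hkl (Fin.ext h)) ha hb)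
    ((hS k).isStabilized i) ((hS l).isStabilized j)]
  simp [ZMod.card]

lemma IsStabilized.mulVec_of_conj {L L' : Finset (Fin m ⊕ Fin m → ZMod 2)}
    {U : Matrix (Fin m → ZMod 2) (Fin m → ZMod 2) ℂ}
    (hU : U ∈ unitaryGroup (Fin m → ZMod 2) ℂ)
    (hL : ∀ b ∈ L', ∃ a ∈ L, ∃ ω : ℂ, ω ≠ 0 ∧ U * pauliZX a * Uᴴ = ω • pauliZX b)
    {ψ : (Fin m → ZMod 2) → ℂ} (h : IsStabilized L ψ) : IsStabilized L' (U *ᵥ ψ) := by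
  have hUU : Uᴴ * U = 1 := mem_unitaryGroup_iff'.1 hU
  refine ⟨?_, fun b hb => ?_⟩
  · rw [star_mulVec, ← dotProduct_mulVec, mulVec_mulVec, hUU, one_mulVec, h.1]
  · obtain ⟨a, ha, ω, hω, hab⟩ := hL b hb
    obtain ⟨μ, hμ⟩ := h.2 a ha
    refine ⟨ω⁻¹ * μ, ?_⟩
    have h2 : (ω • pauliZX b) *ᵥ (U *ᵥ ψ) = μ • (U *ᵥ ψ) := by
      rw [← hab, mulVec_mulVec, Matrix.mul_assoc, hUU, Matrix.mul_one, ← mulVec_mulVec, hμ,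
        mulVec_smul]
    rw [mul_smul, ← h2, smul_mulVec, smul_smul, inv_mul_cancel₀ hω, one_smul]

/-- Two orthonormal bases that are stabilized by the same maximal set of Pauli operators differ
by a monomial matrix. -/
lemma exists_isMonomialPhase {L : Finset (Fin m ⊕ Fin m → ZMod 2)} (hL : L.card = 2 ^ m)
    {V V' : Matrix (Fin m → ZMod 2) (Fin m → ZMod 2) ℂ}
    (hV : V ∈ unitaryGroup (Fin m → ZMod 2) ℂ) (hV' : V' ∈ unitaryGroup (Fin m → ZMod 2) ℂ)
    (h : ∀ i, IsStabilized L (V.col i)) (h' : ∀ i, IsStabilized L (V'.col i)) :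
    ∃ W, IsMonomialPhase W ∧ V' = V * W := by
  refine ⟨star V * V', isMonomialPhase_of_unitary (mul_mem (Unitary.star_mem hV) hV') fun i j => ?_, ?_⟩
  -- The entries of `star V * V'` are the overlaps of the two bases.
  · exact (h i).overlap_eq_zero_or_norm_eq_one hL (h' j)
  · rw [← Matrix.mul_assoc, mem_unitaryGroup_iff.1 hV, Matrix.one_mul]

lemma IsFibonacciBased.exists_isEquivalenceOfBases (hm : m ≠ 0)
    {S S' : Fin (2 ^ m + 1) → Matrix (Fin m → ZMod 2) (Fin m → ZMod 2) ℂ}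
    (h : IsFibonacciBased S) (h' : IsFibonacciBased S') :
    ∃ U, IsClifford U ∧ IsEquivalenceOfBases U S S' := by
  obtain ⟨B, hB, hS⟩ := h
  obtain ⟨B', hB', hS'⟩ := h'
  obtain ⟨ρ⟩ := hB.nonempty_fieldRep
  obtain ⟨ρ'⟩ := hB'.nonempty_fieldRep
  obtain ⟨Q, R, hQR, σ, hσ⟩ := ρ.exists_blockMap ρ' hm
  let U := (basisPerm Q R hQR).permMatrix ℂ
  have hU : U ∈ unitaryGroup (Fin m → ZMod 2) ℂ := permMatrix_mem_unitaryGroup _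
  have hconj := fun a => (permMatrix_mul_mul_conjTranspose (basisPerm Q R hQR) (pauliZX a)).trans
    (pauliZX_submatrix_basisPerm hQR a)
  -- `σ` sends class indices of `B` to those of `B'`, whereas the equivalence asks which basis of
  -- `S` lands on `S' j`; hence the inverse.
  refine ⟨U, ⟨hU, fun a => ⟨_, _, hconj a⟩⟩, hU, σ.symm, fun j => ?_⟩
  refine exists_isMonomialPhase (ρ'.card_classArgs (j := j) (by omega))
    (mul_mem hU (hS _).1) (hS' j).1 (fun i => ?_) fun i => (hS' j).isStabilized i
  refine ((hS (σ.symm j)).isStabilized i).mulVec_of_conj hU fun b hb => ?_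
  have hb' := FieldRep.blockMap_blockMap hQR b
  -- Exchanging `Q` and `R` inverts the block map, which gives the preimage of `b`.
  refine ⟨FieldRep.blockMap R Q b, (hσ _ _).2 ?_, _, ?_, (hconj _).trans (by rw [hb'])⟩
  · rwa [hb', Equiv.apply_symm_apply]
  · exact div_ne_zero (pauliPhase_ne_zero _) (pauliPhase_ne_zero _)

end Main

end FibMUB

/-- Every Fibonacci-based family of bases in dimension `2 ^ m` is a set of `2 ^ m + 1` mutually
unbiased bases, and any two such families are equivalent by a Clifford unitary. -/
theorem mainTheorem3 (m : ℕ) (hm : 1 ≤ m) :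
    (∀ S : Fin (2 ^ m + 1) → Matrix (Fin m → ZMod 2) (Fin m → ZMod 2) ℂ,
      FibMUB.IsFibonacciBased S → FibMUB.IsMUB S) ∧
    (∀ S S' : Fin (2 ^ m + 1) → Matrix (Fin m → ZMod 2) (Fin m → ZMod 2) ℂ,
      FibMUB.IsFibonacciBased S → FibMUB.IsFibonacciBased S' →
        ∃ U : Matrix (Fin m → ZMod 2) (Fin m → ZMod 2) ℂ,
          FibMUB.IsClifford U ∧ FibMUB.IsEquivalenceOfBases U S S') :=
  ⟨fun _ h => h.isMUB, fun _ _ h h' => h.exists_isEquivalenceOfBases (by omega) h'⟩
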